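/- Let $N\in\mathbb N$ and $M>0$, and let $a_{jk}:[0,\infty)\times\mathbb R^N\to[0,M]$ $(j,k=1,\dots,N)$ be universally measurable, i.e. measurable with respect to the completion of every Borel probability measure. Let $\bar x:[0,\infty)\to\mathbb R^N$ be a Carathéodory solution (locally absolutely continuous, satisfying the equations at a.e. $t>0$) of $$\dot x_j=\sum_{k=1}^N a_{jk}(t,x)\,(x_k-x_j),\qquad j=1,\dots,N,$$ and put $\bar x_0=\bar x(0)$ and, with the Euclidean norm, $$a^-_{jk}(t)=\inf\{a_{jk}(t,x)\ :\ \|x-\bar x_0\|\le M\sqrt N\,t\},\qquad t\ge 0.$$ For measurable $f_n,f:[0,\infty)\to[0,\infty)$ that are integrable on compact intervals, write $f_n\overset{*}{\rightharpoonup}f$ if $\int_a^b f_n\to\int_a^b f$ for all bounded intervals $[a,b]\subset[0,\infty)$. A node $\ell$ of a directed graph is globally reachable if from every node there is a directed path to $\ell$ (the trivial path from $\ell$ to itself being allowed). Suppose that at least one of the following three hypotheses holds. 1. The $a^-_{jk}$ are Lebesgue measurable, and there are a sequence $t_n\to+\infty$ in $[0,\infty)$ and functions $a^*_{jk}:[0,\infty)\to[0,\infty)$,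 integrable on compact intervals, with $a^-_{jk}(t_n+\cdot)\overset{*}{\rightharpoonup}a^*_{jk}$ for all $j,k$, such that the directed graph on $\{1,\dots,N\}$ with an arrow from $j$ to $k$ whenever $\int_t^{\infty}a^*_{jk}>0$ for all $t>0$ has a globally reachable node. 2. The $a^-_{jk}$ are Lebesgue measurable (they are automatically bounded), and the following directed graph on $\{1,\dots,N\}$ has a globally reachable node: there is an arrow from $j$ to $k$ whenever $f=a^-_{jk}$ satisfies one of (A) $\limsup_{T\to+\infty}\liminf_{t\to+\infty}\int_t^{t+T}f>0$; (B) there are $T,\mu>0$ with $\int_t^{t+T}f\ge\mu$ for all $t\ge0$; (C) there are $T,\mu>0$ and a sequence $t_n\to+\infty$ in $[0,\infty)$, with $\{t_{n+1}-t_n\}_n$ bounded, such that $\int_{t_n}^{t_n+T}f\ge\mu$ for all $n$. 3. The $a^-_{jk}$ are Lebesgue measurable, and there are $t_n\to+\infty$ in $[0,\infty)$ and $a^*_{jk}$ as in the first sentence of hypothesis 1, with $a^-_{jk}(t_n+\cdot)\overset{*}{\rightharpoonup}a^*_{jk}$ for all $j,k$, such that for each pair $j\neq k$ at least one of $\int_0^\infty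 a^*_{jk}>0$ and $\int_0^\infty a^*_{kj}>0$ holds. Then the trajectory $\bar x$ converges to consensus: there is $\bar x^*\in\mathbb R$ such that $\bar x_j(t)\to\bar x^*$ as $t\to+\infty$ for every $j=1,\dots,N$. -/

import Mathlib

open MeasureTheory Filter Topology
open scoped ENNReal NNReal

namespace Consensus

/-- `f` is measurable for (the completion of) every Borel probability measure. -/
def UniversallyMeasurable {X Y : Type*} [MeasurableSpace X] [MeasurableSpace Y]
    (f : X → Y) : Prop :=
  ∀ p : Measure X, IsProbabilityMeasure p → NullMeasurable f p

/-- `f : [0,∞) → [0,∞)` is Lebesgue measurable and integrable on compact intervals.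
Functions of time are functions on `ℝ` of which only the values at `t ≥ 0` are used. -/
def NonnegLocallyIntegrable (f : ℝ → ℝ) : Prop :=
  (∀ t, 0 ≤ t → 0 ≤ f t) ∧ ∀ T, 0 < T → IntegrableOn f (Set.Icc 0 T) volume

/-- Convergence of the integrals over all bounded intervals `[a, b] ⊆ [0,∞)`. -/
def IntervalConv (f : ℕ → ℝ → ℝ) (g : ℝ → ℝ) : Prop :=
  ∀ a b : ℝ, 0 ≤ a → a ≤ b →
    Tendsto (fun n => ∫ s in a..b, f n s) atTop (𝓝 (∫ s in a..b, g s))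

/-- The integral over `S ⊆ [0,∞)`, possibly infinite, of a nonnegative function. -/
noncomputable def mass (f : ℝ → ℝ) (S : Set ℝ) : ℝ≥0∞ :=
  ∫⁻ s in S, ENNReal.ofReal (f s)

/-- From every node there is a (possibly trivial) directed path to `l`. -/
def GloballyReachable {V : Type*} (G : Digraph V) (l : V) : Prop :=
  ∀ i, Relation.ReflTransGen G.Adj i l

/-- Arrow from `j` to `k` iff `∫_t^∞ a*_jk > 0` for all `t > 0`. -/
def tailGraph {N : ℕ} (aStar : Fin N → Fin N → ℝ → ℝ) : Digraph (Fin N) where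
  Adj j k := ∀ t, 0 < t → 0 < mass (aStar j k) (Set.Ioi t)

/-- Arrow from `j` to `k` iff `∫_0^∞ a*_jk > 0`. -/
def totalGraph {N : ℕ} (aStar : Fin N → Fin N → ℝ → ℝ) : Digraph (Fin N) where
  Adj j k := 0 < mass (aStar j k) (Set.Ioi 0)

/-- All `a_jk`, `a*_jk` are nonnegative and locally integrable, `t_n → ∞` in `[0,∞)`, and
for all `j, k` the translates `a_jk(t_n + ·)` converge to `a*_jk` on bounded intervals. -/
structure HasLimitAlong {N : ℕ} (a aStar : Fin N → Fin N → ℝ → ℝ) (t : ℕ → ℝ) : Prop where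
  locInt : ∀ j k, NonnegLocallyIntegrable (a j k)
  locInt_limit : ∀ j k, NonnegLocallyIntegrable (aStar j k)
  times_nonneg : ∀ n, 0 ≤ t n
  times_tendsto : Tendsto t atTop atTop
  conv : ∀ j k, IntervalConv (fun n s => a j k (t n + s)) (aStar j k)

/-- Some limit of translates has a tail graph with a globally reachable node. -/
def LimitReachable {N : ℕ} (a : Fin N → Fin N → ℝ → ℝ) : Prop :=
  ∃ (aStar : Fin N → Fin N → ℝ → ℝ) (t : ℕ → ℝ), HasLimitAlong a aStar t ∧
    ∃ l, GloballyReachable (tailGraph aStar) l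

/-- Some limit of translates has a graph in which any two distinct nodes are joined
by an arrow in at least one direction. -/
def LimitPairwiseJoined {N : ℕ} (a : Fin N → Fin N → ℝ → ℝ) : Prop :=
  ∃ (aStar : Fin N → Fin N → ℝ → ℝ) (t : ℕ → ℝ), HasLimitAlong a aStar t ∧
    ∀ j k, j ≠ k → (totalGraph aStar).Adj j k ∨ (totalGraph aStar).Adj k j

/-- `limsup_{T → ∞} liminf_{t → ∞} ∫_t^{t+T} f > 0`. -/
def PersistentA (f : ℝ → ℝ) : Prop :=
  0 < limsup (fun T : ℝ => liminf (fun t : ℝ => mass f (Set.Icc t (t + T))) atTop) atTop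

/-- `∫_t^{t+T} f ≥ μ` for all `t ≥ 0`, for some `T, μ > 0`. -/
def PersistentB (f : ℝ → ℝ) : Prop :=
  ∃ T μ : ℝ, 0 < T ∧ 0 < μ ∧
    ∀ t, 0 ≤ t → ENNReal.ofReal μ ≤ mass f (Set.Icc t (t + T))

/-- `∫_{t_n}^{t_n+T} f ≥ μ` for all `n`, for some `T, μ > 0` and some sequence
`t_n → ∞` with bounded increments. -/
def PersistentC (f : ℝ → ℝ) : Prop :=
  ∃ (T μ : ℝ) (t : ℕ → ℝ), 0 < T ∧ 0 < μ ∧ (∀ n, 0 ≤ t n) ∧ Tendsto t atTop atTop ∧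
    (∃ K : ℝ, ∀ n, |t (n + 1) - t n| ≤ K) ∧
    ∀ n, ENNReal.ofReal μ ≤ mass f (Set.Icc (t n) (t n + T))

/-- Arrow from `j` to `k` iff `a_jk` satisfies one of the three persistence properties. -/
def persistenceGraph {N : ℕ} (a : Fin N → Fin N → ℝ → ℝ) : Digraph (Fin N) where
  Adj j k := PersistentA (a j k) ∨ PersistentB (a j k) ∨ PersistentC (a j k)

/-- All `a_jk : [0,∞) → [0,∞)` are Lebesgue measurable and bounded, and the persistence
graph has a globally reachable node. -/
def PersistentlyReachable {N : ℕ} (a : Fin N → Fin N → ℝ → ℝ) : Prop :=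
  (∀ j k, NullMeasurable (a j k) (volume.restrict (Set.Ici 0))) ∧
  (∀ j k t, 0 ≤ t → 0 ≤ a j k t) ∧
  (∀ j k, ∃ C, ∀ t, 0 ≤ t → a j k t ≤ C) ∧
  ∃ l, GloballyReachable (persistenceGraph a) l

/-- Global Carathéodory solutions of `x_j' = ∑_k a_jk(t, x) (x_k - x_j)` on `[0,∞)`:
locally absolutely continuous curves that satisfy the system at almost every time. -/
def IsSolution {N : ℕ} (a : Fin N → Fin N → ℝ → EuclideanSpace ℝ (Fin N) → ℝ)
    (x : ℝ → EuclideanSpace ℝ (Fin N)) : Prop :=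
  (∀ T, 0 < T → AbsolutelyContinuousOnInterval x 0 T) ∧
  ∀ᵐ t ∂(volume.restrict (Set.Ioi (0 : ℝ))), ∀ j,
    HasDerivAt (fun s => x s j) (∑ k, a j k t (x t) * (x t k - x t j)) t

/-- `a⁻_jk(t) = inf { a_jk(t, y) : ‖y - x₀‖ ≤ M √N t }`, with the Euclidean norm. -/
noncomputable def lowerEnvelope {N : ℕ} (M : ℝ)
    (a : Fin N → Fin N → ℝ → EuclideanSpace ℝ (Fin N) → ℝ) (x₀ : EuclideanSpace ℝ (Fin N)) :
    Fin N → Fin N → ℝ → ℝ :=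
  fun j k t => sInf {r | ∃ y, ‖y - x₀‖ ≤ M * Real.sqrt N * t ∧ a j k t y = r}

end Consensus

/-!
Evaluating the coefficients along the given solution turns the system into a linear one,
`y_j' = ∑ k, c_jk(t) (y_k - y_j)` with `0 ≤ c_jk ≤ M`. Its maximum `max_j y_j` is nonincreasing and
its minimum nondecreasing (`IsFlow.le_of_le`), so both have limits, `V` and `-W`, and consensus
means that these agree. In particular the solution is bounded; as the radii `M √N t` grow to
infinity, the lower envelope `b_jk` of `a_jk` satisfies `b_jk ≤ c_jk` for all late times
(`IsFlow.exists_lowerEnvelope_le`), which suffices because each hypothesis provides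
interaction at arbitrarily late times.

If `V` bounds all coordinates at time `s`, the gaps `u_i = V - y_i` satisfy, with `L = N M`,
`u_j' ≥ -L u_j + c_jk u_k`. Hence `u_j(s) ≤ e^{L(t-s)} u_j(t)` and
`u_k(s) ∫_s^t b_jk ≤ e^{L(t-s)} u_j(t)` (`IsFlow.gap_le`, `IsFlow.gap_mul_integral_le`).

Let `z` be the pointwise limit of the translates `y(t_n + ·)` along a free ultrafilter. At each time
the maximum of `z` is exactly `V`, and by the first inequality a coordinate of `z` that drops below
`V` never returns. As there are finitely many coordinates, some `z_j` is identically `V`. By the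
second inequality, if the integrals of `b_jk` over windows `[t_n + s, t_n + s']` stay bounded away
from zero (`ActiveAfter`), then `z_j ≡ V` implies `z_k(s) = V`
(`IsFlow.exists_translateLimit_eq_max`). The same holds for `-y`, that is, for the minimum.

A positive integral of a limit `a*_jk` makes the pair `(j, k)` active, and so does each of the
persistence properties along `t_n = n`. With a globally reachable node `l`, following arrows from
a coordinate at the maximum and from one at the minimum shows that `z_l` equals both `V` and `-W`.
With all pairs joined, an arrow between a coordinate at the maximum and one at the minimum gives
the same conclusion (`IsFlow.exists_consensus_of_active`).
-/

namespace Consensus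

/-! ### Absolutely continuous functions -/

theorem _root_.AbsolutelyContinuousOnInterval.lipschitzWith_comp {X Y : Type*}
    [PseudoMetricSpace X] [PseudoMetricSpace Y] {K : ℝ≥0} {g : X → Y} (hg : LipschitzWith K g)
    {f : ℝ → X} {a b : ℝ} (hf : AbsolutelyContinuousOnInterval f a b) :
    AbsolutelyContinuousOnInterval (fun t => g (f t)) a b := by
  rw [absolutelyContinuousOnInterval_iff] at hf ⊢
  intro ε hε
  obtain ⟨δ, hδ, h⟩ := hf (ε / (K + 1)) (by positivity)
  refine ⟨δ, hδ, fun E hE hE' => ?_⟩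
  calc ∑ i ∈ Finset.range E.1, dist (g (f (E.2 i).1)) (g (f (E.2 i).2))
      ≤ ∑ i ∈ Finset.range E.1, (K + 1) * dist (f (E.2 i).1) (f (E.2 i).2) := by
        gcongr with i
        exact (hg.dist_le_mul _ _).trans (by gcongr; linarith)
    _ = (K + 1) * ∑ i ∈ Finset.range E.1, dist (f (E.2 i).1) (f (E.2 i).2) := by
        rw [Finset.mul_sum]
    _ < (K + 1) * (ε / (K + 1)) := by
        gcongr
        exact h E hE hE'
    _ = ε := by field_simp

theorem _root_.AbsolutelyContinuousOnInterval.finset_sum {ι F : Type*} [NormedAddCommGroup F]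
    {a b : ℝ} (s : Finset ι) {f : ι → ℝ → F}
    (hf : ∀ i ∈ s, AbsolutelyContinuousOnInterval (f i) a b) :
    AbsolutelyContinuousOnInterval (fun t => ∑ i ∈ s, f i t) a b := by
  classical
  induction s using Finset.induction_on with
  | empty =>
    simpa using (LipschitzWith.const (0 : F)).lipschitzOnWith.absolutelyContinuousOnInterval
  | insert i s hi ih =>
    simp only [Finset.sum_insert hi]
    exact (hf i (by simp)).fun_add (ih fun k hk => hf k (by simp [hk]))

/-- A lower bound for the derivative of an absolutely continuous function can be integrated. -/
theorem _root_.AbsolutelyContinuousOnInterval.integral_le_sub {f h : ℝ → ℝ} {a b : ℝ} (hab : a ≤ b)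
    (hf : AbsolutelyContinuousOnInterval f a b) (hh : IntervalIntegrable h volume a b)
    (hd : ∀ᵐ t, t ∈ Set.Ioc a b → ∃ d, HasDerivAt f d t ∧ h t ≤ d) :
    ∫ t in a..b, h t ≤ f b - f a := by
  rw [← hf.integral_deriv_eq_sub, intervalIntegral.integral_of_le hab,
    intervalIntegral.integral_of_le hab]
  refine setIntegral_mono_ae_restrict hh.1 hf.intervalIntegrable_deriv.1 ?_
  rw [EventuallyLE, ae_restrict_iff' measurableSet_Ioc]
  filter_upwards [hd] with t ht hts
  obtain ⟨d, hd, hle⟩ := ht hts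
  rwa [hd.deriv]

theorem hasDerivAt_sq_posPart (y : ℝ) :
    HasDerivAt (fun y : ℝ => (max y 0) ^ 2) (2 * max y 0) y := by
  rcases lt_trichotomy y 0 with hy | rfl | hy
  · rw [max_eq_right hy.le, mul_zero]
    refine (hasDerivAt_const y (0 : ℝ)).congr_of_eventuallyEq ?_
    filter_upwards [Iio_mem_nhds hy] with z hz
    rw [max_eq_right (le_of_lt hz)]
    norm_num
  · rw [max_self, mul_zero, hasDerivAt_iff_isLittleO]
    have h2 : (fun z : ℝ => z ^ 2) =o[𝓝 0] fun z => z := by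
      simpa using Asymptotics.isLittleO_pow_id (𝕜 := ℝ) (one_lt_two)
    refine (Asymptotics.IsBigO.of_bound 1 (Eventually.of_forall fun z => ?_)).trans_isLittleO
      (by simpa using h2)
    rcases le_total z 0 with hz | hz <;> simp [hz]
    positivity
  · rw [max_eq_left hy.le]
    refine HasDerivAt.congr_of_eventuallyEq (f := fun z : ℝ => z ^ 2) ?_ ?_
    · simpa using hasDerivAt_pow 2 y
    filter_upwards [Ioi_mem_nhds hy] with z hz
    rw [max_eq_left (le_of_lt hz)]

theorem absolutelyContinuousOnInterval_exp {s t : ℝ} (L : ℝ) :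
    AbsolutelyContinuousOnInterval (fun τ => Real.exp (L * (τ - s))) s t := by
  refine ContDiffOn.absolutelyContinuousOnInterval (ContDiff.contDiffOn ?_)
  fun_prop

theorem hasDerivAt_exp (L s τ : ℝ) :
    HasDerivAt (fun τ => Real.exp (L * (τ - s))) (Real.exp (L * (τ - s)) * L) τ := by
  have h1 : HasDerivAt (fun τ => L * (τ - s)) L τ := by
    simpa using ((hasDerivAt_id τ).sub_const s).const_mul L
  exact h1.exp

/-! ### Trajectories of a linear consensus system -/

/-- The coordinates `y i` solve, on `[0,∞)` and in the sense of Carathéodory, the linear system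
with coefficients `c i k t` in `[0, M]`. No measurability of the coefficients is required. -/
structure IsFlow {ι : Type*} [Fintype ι] (M : ℝ) (c : ι → ι → ℝ → ℝ) (y : ι → ℝ → ℝ) : Prop where
  bound : ∀ j k t, 0 ≤ t → c j k t ∈ Set.Icc 0 M
  ac : ∀ j T, 0 < T → AbsolutelyContinuousOnInterval (y j) 0 T
  deriv : ∀ᵐ t ∂(volume.restrict (Set.Ioi (0 : ℝ))), ∀ j,
    HasDerivAt (y j) (∑ k, c j k t * (y k t - y j t)) t

/-- There is a uniform positive lower bound, for all large `n`, of the integral of `b` over a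
window `[t n + s, t n + s']` with some fixed `s' ≥ s`. -/
def ActiveAfter (b : ℝ → ℝ) (t : ℕ → ℝ) (s : ℝ) : Prop :=
  ∃ s' μ, s ≤ s' ∧ 0 < μ ∧ ∀ᶠ n in atTop, μ ≤ ∫ τ in (t n + s)..(t n + s'), b τ

namespace IsFlow

variable {ι : Type*} [Fintype ι] {M : ℝ} {c : ι → ι → ℝ → ℝ} {y : ι → ℝ → ℝ}

theorem neg (h : IsFlow M c y) : IsFlow M c (fun i t => -y i t) where
  bound := h.bound
  ac j T hT := (h.ac j T hT).fun_neg
  deriv := by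
    filter_upwards [h.deriv] with t ht j
    refine (ht j).fun_neg.congr_deriv ?_
    rw [← Finset.sum_neg_distrib]
    exact Finset.sum_congr rfl fun k _ => by ring

theorem ac_of_le (h : IsFlow M c y) (j : ι) {s t : ℝ} (hs : 0 ≤ s) (hst : s ≤ t) :
    AbsolutelyContinuousOnInterval (y j) s t := by
  refine (h.ac j (t + 1) (by linarith)).mono ?_
  rw [Set.uIcc_of_le hst, Set.uIcc_of_le (by linarith)]
  exact Set.Icc_subset_Icc hs (by linarith)

theorem deriv_of_nonneg (h : IsFlow M c y) {s t : ℝ} (hs : 0 ≤ s) :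
    ∀ᵐ τ, τ ∈ Set.Ioc s t → ∀ j, HasDerivAt (y j) (∑ k, c j k τ * (y k τ - y j τ)) τ := by
  have := h.deriv
  rw [ae_restrict_iff' measurableSet_Ioi] at this
  filter_upwards [this] with τ hτ hτ'
  exact hτ (hs.trans_lt hτ'.1)

/-- Upper bounds for all coordinates are preserved: by Grönwall's inequality, the sum of the
squared excesses over the bound stays zero. -/
theorem le_of_le (h : IsFlow M c y) {V s t : ℝ} (hs : 0 ≤ s) (hst : s ≤ t)
    (hV : ∀ i, y i s ≤ V) (i : ι) : y i t ≤ V := by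
  set K : ℝ := Fintype.card ι * M with hK
  let w : ℝ → ℝ := fun τ => ∑ i, (max (y i τ - V) 0) ^ 2
  have hwac : AbsolutelyContinuousOnInterval w s t := by
    refine AbsolutelyContinuousOnInterval.finset_sum _ fun i _ => ?_
    have h1 : AbsolutelyContinuousOnInterval (fun τ => max (y i τ - V) 0) s t :=
      (h.ac_of_le i hs hst).lipschitzWith_comp (K := 1) (g := fun z => max (z - V) 0) <| by
        refine LipschitzWith.of_dist_le_mul fun p q => ?_
        have := abs_max_sub_max_le_abs (p - V) (q - V) 0
        simpa [Real.dist_eq] using this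
    simpa only [sq] using h1.fun_mul h1
  have hf : AbsolutelyContinuousOnInterval
      (fun τ => -(Real.exp (-K * (τ - s)) * w τ)) s t :=
    ((absolutelyContinuousOnInterval_exp (-K)).fun_mul hwac).fun_neg
  have key := hf.integral_le_sub hst (h := fun _ => 0) (by simp) <| by
    filter_upwards [h.deriv_of_nonneg (t := t) hs] with τ hτ hτs
    have hw : HasDerivAt w (∑ i, 2 * max (y i τ - V) 0 * ∑ k, c i k τ * (y k τ - y i τ)) τ := by
      refine HasDerivAt.fun_sum fun i _ => ?_
      exact (hasDerivAt_sq_posPart (y i τ - V)).comp τ ((hτ hτs i).sub_const V)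
    refine ⟨_, ((hasDerivAt_exp (-K) s τ).mul hw).neg, ?_⟩
    have hle : ∑ i, 2 * max (y i τ - V) 0 * ∑ k, c i k τ * (y k τ - y i τ) ≤ K * w τ := by
      calc ∑ i, 2 * max (y i τ - V) 0 * ∑ k, c i k τ * (y k τ - y i τ)
          ≤ ∑ _i : ι, ∑ k, M * (max (y k τ - V) 0) ^ 2 := by
            refine Finset.sum_le_sum fun i _ => ?_
            rw [Finset.mul_sum]
            refine Finset.sum_le_sum fun k _ => ?_
            obtain ⟨hc0, hcM⟩ := h.bound i k τ (hs.trans hτs.1.le)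
            set p := max (y i τ - V) 0 with hp
            set q := max (y k τ - V) 0 with hq
            have hp0 : 0 ≤ p := le_max_right _ _
            have h1 : p * (y k τ - y i τ) ≤ p * (q - p) := by
              have hqk : y k τ - V ≤ q := le_max_left _ _
              rcases le_total (y i τ - V) 0 with hi | hi
              · have : p = 0 := max_eq_right hi
                simp [this]
              · have : p = y i τ - V := max_eq_left hi
                exact mul_le_mul_of_nonneg_left (by linarith) hp0
            have h2 : 2 * (p * (q - p)) ≤ q ^ 2 := by nlinarith [sq_nonneg (p - q), sq_nonneg p]
            calc 2 * p * (c i k τ * (y k τ - y i τ)) = c i k τ * (2 * (p * (y k τ - y i τ))) := by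
                  ring
              _ ≤ c i k τ * q ^ 2 := by gcongr; linarith
              _ ≤ M * q ^ 2 := by gcongr
        _ = K * w τ := by
            simp only [w, hK, Finset.sum_const, Finset.card_univ, nsmul_eq_mul, Finset.mul_sum,
              mul_assoc]
    have := mul_le_mul_of_nonneg_left hle (Real.exp_pos (-K * (τ - s))).le
    linarith
  have hws : w s = 0 := Finset.sum_eq_zero fun i _ => by simp [hV i]
  simp only [intervalIntegral.integral_zero, hws, mul_zero, neg_zero, sub_zero] at key
  have hwt : w t ≤ 0 := by
    have := Real.exp_pos (-K * (t - s))
    by_contra! hcon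
    nlinarith [mul_pos this hcon]
  have h3 : (max (y i t - V) 0) ^ 2 ≤ w t :=
    Finset.single_le_sum (f := fun i => (max (y i t - V) 0) ^ 2) (fun i _ => sq_nonneg _)
      (Finset.mem_univ i)
  have h4 : max (y i t - V) 0 = 0 := by
    have := le_antisymm (h3.trans hwt) (sq_nonneg _)
    exact pow_eq_zero_iff (two_ne_zero) |>.1 this
  have := le_max_left (y i t - V) 0
  linarith

/-- The basic growth estimate: multiplied by `e^{L (t - s)}` with `L = card ι * M`, the gap between
`y j` and an upper bound `V` is nondecreasing, and it grows at least at the rate contributed by the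
single coefficient `c j k`, of which `b` is an integrable lower bound. -/
theorem gap_add_integral_le (h : IsFlow M c y) {V s t : ℝ} (hs : 0 ≤ s) (hst : s ≤ t)
    (hV : ∀ i, y i s ≤ V) (j k : ι) {b : ℝ → ℝ} (hb : IntervalIntegrable b volume s t)
    (hbc : ∀ τ ∈ Set.Ioc s t,
      b τ ≤ Real.exp (Fintype.card ι * M * (τ - s)) * (c j k τ * (V - y k τ))) :
    V - y j s + ∫ τ in s..t, b τ ≤ Real.exp (Fintype.card ι * M * (t - s)) * (V - y j t) := by
  set L : ℝ := Fintype.card ι * M with hL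
  have hu : AbsolutelyContinuousOnInterval (fun τ => V - y j τ) s t := by
    refine (h.ac_of_le j hs hst).lipschitzWith_comp (K := 1) (g := fun z => V - z) ?_
    exact LipschitzWith.of_dist_le_mul fun p q => by
      rw [NNReal.coe_one, one_mul, dist_sub_left]
  have key := ((absolutelyContinuousOnInterval_exp L).fun_mul hu).integral_le_sub hst hb <| by
    filter_upwards [h.deriv_of_nonneg (t := t) hs] with τ hτ hτs
    refine ⟨_, (hasDerivAt_exp L s τ).mul ((hτ hτs j).const_sub V), (hbc τ hτs).trans ?_⟩
    have hτ0 : 0 ≤ τ := hs.trans hτs.1.le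
    have hu0 : ∀ i, 0 ≤ V - y i τ := fun i => sub_nonneg.2 (h.le_of_le hs hτs.1.le hV i)
    have h1 : L * (V - y j τ) - ∑ i, c j i τ * (y i τ - y j τ)
        = ∑ i, ((M - c j i τ) * (V - y j τ) + c j i τ * (V - y i τ)) := by
      have : L * (V - y j τ) = ∑ _i : ι, M * (V - y j τ) := by
        simp [hL, mul_assoc]
      rw [this, ← Finset.sum_sub_distrib]
      exact Finset.sum_congr rfl fun i _ => by ring
    have h2 : c j k τ * (V - y k τ) ≤ L * (V - y j τ) - ∑ i, c j i τ * (y i τ - y j τ) := by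
      rw [h1]
      have hnn : ∀ i, 0 ≤ (M - c j i τ) * (V - y j τ) := fun i =>
        mul_nonneg (sub_nonneg.2 (h.bound j i τ hτ0).2) (hu0 j)
      refine le_trans ?_ (Finset.single_le_sum
        (f := fun i => (M - c j i τ) * (V - y j τ) + c j i τ * (V - y i τ))
        (fun i _ => add_nonneg (hnn i) (mul_nonneg (h.bound j i τ hτ0).1 (hu0 i)))
        (Finset.mem_univ k))
      linarith [hnn k]
    have := mul_le_mul_of_nonneg_left h2 (Real.exp_pos (L * (τ - s))).le
    linarith
  simp only [sub_self, mul_zero, Real.exp_zero, one_mul] at key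
  linarith

theorem gap_le (h : IsFlow M c y) {V s t : ℝ} (hs : 0 ≤ s) (hst : s ≤ t)
    (hV : ∀ i, y i s ≤ V) (j : ι) :
    V - y j s ≤ Real.exp (Fintype.card ι * M * (t - s)) * (V - y j t) := by
  simpa using h.gap_add_integral_le hs hst hV j j (b := fun _ => 0) (by simp) fun τ hτ =>
    mul_nonneg (Real.exp_pos _).le (mul_nonneg (h.bound j j τ (hs.trans hτ.1.le)).1
      (sub_nonneg.2 (h.le_of_le hs hτ.1.le hV j)))

/-- If `b` bounds the coefficient `c j k` from below on `[s, t]`, then a gap of `y k` at time `s`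
forces a gap of `y j` at time `t` proportional to the integral of `b`. -/
theorem gap_mul_integral_le (h : IsFlow M c y) {V s t : ℝ} (hs : 0 ≤ s) (hst : s ≤ t)
    (hV : ∀ i, y i s ≤ V) (j k : ι) {b : ℝ → ℝ} (hb : IntervalIntegrable b volume s t)
    (hbc : ∀ τ, s ≤ τ → b τ ≤ c j k τ) :
    (V - y k s) * ∫ τ in s..t, b τ ≤ Real.exp (Fintype.card ι * M * (t - s)) * (V - y j t) := by
  have := h.gap_add_integral_le hs hst hV j k (hb.const_mul (V - y k s)) fun τ hτ => by
    have h1 := h.gap_le hs hτ.1.le hV k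
    have hc := (h.bound j k τ (hs.trans hτ.1.le)).1
    calc (V - y k s) * b τ ≤ (V - y k s) * c j k τ :=
          mul_le_mul_of_nonneg_left (hbc τ hτ.1.le) (sub_nonneg.2 (hV k))
      _ ≤ (Real.exp (Fintype.card ι * M * (τ - s)) * (V - y k τ)) * c j k τ :=
          mul_le_mul_of_nonneg_right h1 hc
      _ = _ := by ring
  rw [intervalIntegral.integral_const_mul] at this
  linarith [hV j]

theorem exists_abs_le (h : IsFlow M c y) : ∃ C, ∀ i t, 0 ≤ t → |y i t| ≤ C := by
  refine ⟨∑ i, |y i 0|, fun i t ht => abs_le.2 ⟨?_, ?_⟩⟩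
  · have := h.neg.le_of_le le_rfl ht (V := ∑ i, |y i 0|) (fun k => (neg_le_abs _).trans
      (Finset.single_le_sum (f := fun i => |y i 0|) (fun _ _ => abs_nonneg _)
        (Finset.mem_univ k))) i
    linarith
  · exact h.le_of_le le_rfl ht (fun k => (le_abs_self _).trans
      (Finset.single_le_sum (f := fun i => |y i 0|) (fun _ _ => abs_nonneg _)
        (Finset.mem_univ k))) i

/-- The limit `V` of the nonincreasing function `t ↦ max i, y i t`. -/
theorem exists_limit_max [Nonempty ι] (h : IsFlow M c y) :
    ∃ V, (∀ ε > 0, ∀ᶠ t in atTop, ∀ i, y i t ≤ V + ε) ∧ ∀ t, 0 ≤ t → ∃ i, V ≤ y i t := by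
  obtain ⟨C, hC⟩ := h.exists_abs_le
  let A : Set ℝ := {v | ∃ s, 0 ≤ s ∧ ∀ i, y i s ≤ v}
  have hne : A.Nonempty := ⟨C, 0, le_rfl, fun i => (abs_le.1 (hC i 0 le_rfl)).2⟩
  have hbd : BddBelow A := by
    refine ⟨-C, fun v ⟨s, hs, hv⟩ => ?_⟩
    obtain ⟨i⟩ := ‹Nonempty ι›
    exact (abs_le.1 (hC i s hs)).1.trans (hv i)
  refine ⟨sInf A, fun ε hε => ?_, fun t ht => ?_⟩
  · obtain ⟨v, ⟨s, hs, hv⟩, hlt⟩ := exists_lt_of_csInf_lt hne (lt_add_of_pos_right (sInf A) hε)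
    filter_upwards [eventually_ge_atTop s] with t ht i
    exact (h.le_of_le hs ht hv i).trans hlt.le
  · obtain ⟨i, hi⟩ := Finite.exists_max fun i => y i t
    exact ⟨i, csInf_le hbd ⟨t, ht, hi⟩⟩

/-! ### Limits of translates along an ultrafilter -/

/-- Pointwise limits of the translated coordinates `y i (t n + ·)` along the free ultrafilter
`hyperfilter ℕ`. An ultrafilter makes all of them exist at once, with no subsequences. -/
def IsTranslateLimit (y : ι → ℝ → ℝ) (t : ℕ → ℝ) (z : ι → ℝ → ℝ) : Prop :=
  ∀ i s, 0 ≤ s → Tendsto (fun n => y i (t n + s)) (hyperfilter ℕ) (𝓝 (z i s))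

theorem exists_isTranslateLimit (h : IsFlow M c y) {t : ℕ → ℝ} (ht : ∀ n, 0 ≤ t n) :
    ∃ z, IsTranslateLimit y t z := by
  obtain ⟨C, hC⟩ := h.exists_abs_le
  have : ∀ i s, ∃ z, 0 ≤ s → Tendsto (fun n => y i (t n + s)) (hyperfilter ℕ) (𝓝 z) := by
    intro i s
    by_cases hs : 0 ≤ s
    · have hmem : Tendsto (fun n => y i (t n + s)) (hyperfilter ℕ) (𝓟 (Set.Icc (-C) C)) :=
        tendsto_principal.2 <| Eventually.of_forall fun n =>
          abs_le.1 (hC i _ (add_nonneg (ht n) hs))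
      obtain ⟨z, -, hz⟩ := isCompact_Icc.ultrafilter_le_nhds
        ((hyperfilter ℕ).map fun n => y i (t n + s)) hmem
      exact ⟨z, fun _ => hz⟩
    · exact ⟨0, fun h => absurd h hs⟩
  choose z hz using this
  exact ⟨z, hz⟩

/-- Let `z` be a limit of translates of `y` and `V` the limit of the maximum of `y`. Some coordinate
of `z` equals `V` at all times, and an active pair `(j, k)` transmits the value `V` backwards
from `j` to `k`. -/
theorem exists_translateLimit_eq_max [Nonempty ι] (h : IsFlow M c y) {b : ι → ι → ℝ → ℝ} {T₀ : ℝ}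
    (hb : ∀ j k s t, 0 ≤ s → s ≤ t → IntervalIntegrable (b j k) volume s t)
    (hbc : ∀ j k τ, T₀ ≤ τ → b j k τ ≤ c j k τ)
    {t : ℕ → ℝ} (ht : ∀ n, 0 ≤ t n) (htop : Tendsto t atTop atTop)
    {z : ι → ℝ → ℝ} (hz : IsTranslateLimit y t z) :
    ∃ V, (∀ ε > 0, ∀ᶠ τ in atTop, ∀ i, y i τ ≤ V + ε) ∧
      (∃ j, ∀ s, 0 ≤ s → z j s = V) ∧
      ∀ j k s, 0 ≤ s → ActiveAfter (b j k) t s → (∀ s', 0 ≤ s' → z j s' = V) → z k s = V := by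
  obtain ⟨V, hV, hV'⟩ := h.exists_limit_max
  have hF : ((hyperfilter ℕ : Ultrafilter ℕ) : Filter ℕ) ≤ atTop := by
    rw [← Nat.cofinite_eq_atTop]
    exact hyperfilter_le_cofinite
  have hshift : ∀ s : ℝ, Tendsto (fun n => t n + s) (hyperfilter ℕ) atTop := fun s =>
    (tendsto_atTop_add_const_right _ s htop).mono_left hF
  have hle : ∀ i s, 0 ≤ s → z i s ≤ V := fun i s hs => le_of_forall_pos_le_add fun ε hε =>
    le_of_tendsto (hz i s hs) <| ((hshift s).eventually (hV ε hε)).mono fun n hn => hn i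
  have hex : ∀ s, 0 ≤ s → ∃ i, z i s = V := by
    intro s hs
    by_contra! hcon
    have hev : ∀ᶠ n in (hyperfilter ℕ : Filter ℕ), ∀ i, y i (t n + s) < V :=
      eventually_all.2 fun i =>
        (hz i s hs).eventually_lt_const (lt_of_le_of_ne (hle i s hs) (hcon i))
    obtain ⟨n, hn⟩ := hev.exists
    obtain ⟨i, hi⟩ := hV' (t n + s) (add_nonneg (ht n) hs)
    exact (hn i).not_ge hi
  -- The gap of a limit coordinate decays at most exponentially, so once positive it stays positive.
  have hback : ∀ i s s', 0 ≤ s → s ≤ s' → z i s' = V → z i s = V := by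
    intro i s s' hs hss' hi
    refine le_antisymm (hle i s hs) (le_of_forall_pos_le_add fun ε hε => ?_)
    set E := Real.exp (Fintype.card ι * M * (s' - s)) with hE
    have hE0 : 0 < E := Real.exp_pos _
    have hlim : Tendsto (fun n => E * (V + ε / E - y i (t n + s')) - (V + ε / E - y i (t n + s)))
        (hyperfilter ℕ) (𝓝 (E * (V + ε / E - z i s') - (V + ε / E - z i s))) :=
      ((tendsto_const_nhds.sub (hz i s' (hs.trans hss'))).const_mul E).sub
        (tendsto_const_nhds.sub (hz i s hs))
    have := ge_of_tendsto (b := 0) hlim <| by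
      filter_upwards [(hshift s).eventually (hV (ε / E) (by positivity))] with n hn
      have := h.gap_le (add_nonneg (ht n) hs) (by linarith : t n + s ≤ t n + s') hn i
      rw [add_sub_add_left_eq_sub, ← hE] at this
      linarith
    rw [hi, add_sub_cancel_left, mul_div_cancel₀ _ hE0.ne'] at this
    have : 0 ≤ ε / E := by positivity
    linarith
  refine ⟨V, hV, ?_, ?_⟩
  · by_contra! hcon
    choose s hs0 hs using hcon
    obtain ⟨i₀, hi₀⟩ := Finite.exists_max s
    obtain ⟨j, hj⟩ := hex (s i₀) (hs0 i₀)
    exact hs j (hback j _ _ (hs0 j) (hi₀ j) hj)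
  · rintro j k s hs ⟨s', μ, hss', hμ, hact⟩ hj
    refine le_antisymm (hle k s hs) (le_of_forall_pos_le_add fun ε hε => ?_)
    set E := Real.exp (Fintype.card ι * M * (s' - s)) with hE
    have hE0 : 0 < E := Real.exp_pos _
    set δ := ε * μ / E with hδ
    have hδ0 : 0 < δ := by positivity
    have hlim : Tendsto (fun n => E * (V + δ - y j (t n + s')) - (V + δ - y k (t n + s)) * μ)
        (hyperfilter ℕ) (𝓝 (E * (V + δ - z j s') - (V + δ - z k s) * μ)) :=
      ((tendsto_const_nhds.sub (hz j s' (hs.trans hss'))).const_mul E).sub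
        ((tendsto_const_nhds.sub (hz k s hs)).mul_const μ)
    have := ge_of_tendsto (b := 0) hlim <| by
      filter_upwards [(hshift s).eventually (hV δ hδ0), hF hact,
        (hshift s).eventually (eventually_ge_atTop T₀)] with n hn hn' hn''
      have h0 : t n + s ≤ t n + s' := by linarith
      have h1 := h.gap_mul_integral_le (add_nonneg (ht n) hs) h0 hn j k
        (hb j k _ _ (add_nonneg (ht n) hs) h0) fun τ hτ => hbc j k τ (hn''.trans hτ)
      rw [add_sub_add_left_eq_sub, ← hE] at h1
      have h2 := mul_le_mul_of_nonneg_left hn' (sub_nonneg.2 (hn k))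
      linarith
    rw [hj s' (hs.trans hss'), add_sub_cancel_left, hδ, mul_div_cancel₀ _ hE0.ne', ← hδ] at this
    have : (V + δ - z k s - ε) * μ ≤ 0 := by linarith
    have := nonpos_of_mul_nonpos_left this hμ
    linarith

/-- If the activity pattern of the lower bounds `b` of the coefficients forces the limits of the
maximum and of the minimum to agree, the trajectory converges to consensus. The sets of nodes
whose limit coordinate stays at the maximum, respectively at the minimum, enter as `P` and `Q`. -/
theorem exists_consensus_of_active [Nonempty ι] (h : IsFlow M c y) {b : ι → ι → ℝ → ℝ} {T₀ : ℝ}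
    (hb : ∀ j k s t, 0 ≤ s → s ≤ t → IntervalIntegrable (b j k) volume s t)
    (hbc : ∀ j k τ, T₀ ≤ τ → b j k τ ≤ c j k τ)
    {t : ℕ → ℝ} (ht : ∀ n, 0 ≤ t n) (htop : Tendsto t atTop atTop)
    (hG : (∃ l, ∀ i, Relation.ReflTransGen
        (fun j k => ∀ s, 0 ≤ s → ActiveAfter (b j k) t s) i l) ∨
      ∀ j k, j ≠ k → ActiveAfter (b j k) t 0 ∨ ActiveAfter (b k j) t 0) :
    ∃ v : ℝ, ∀ i, Tendsto (y i) atTop (𝓝 v) := by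
  obtain ⟨z, hz⟩ := h.exists_isTranslateLimit ht
  obtain ⟨V, hV, ⟨p, hp⟩, hVact⟩ := h.exists_translateLimit_eq_max hb hbc ht htop hz
  obtain ⟨W, hW, ⟨q, hq⟩, hWact⟩ := h.neg.exists_translateLimit_eq_max hb hbc ht htop
    (z := fun i s => -z i s) fun i s hs => (hz i s hs).neg
  have hVW : V = -W := by
    rcases hG with ⟨l, hl⟩ | hG
    · have hlV : ∀ s, 0 ≤ s → z l s = V := by
        have hpl := hl p
        clear hl
        induction hpl with
        | refl => exact hp
        | tail _ hjk ih => exact fun s hs => hVact _ _ s hs (hjk s hs) ih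
      have hlW : ∀ s, 0 ≤ s → -z l s = W := by
        have hql := hl q
        clear hl hlV
        induction hql with
        | refl => exact hq
        | tail _ hjk ih => exact fun s hs => hWact _ _ s hs (hjk s hs) ih
      linarith [hlV 0 le_rfl, hlW 0 le_rfl]
    · rcases eq_or_ne p q with rfl | hpq
      · linarith [hp 0 le_rfl, hq 0 le_rfl]
      rcases hG p q hpq with hact | hact
      · linarith [hVact p q 0 le_rfl hact hp, hq 0 le_rfl]
      · linarith [hWact q p 0 le_rfl hact hq, hp 0 le_rfl]
  refine ⟨V, fun i => Metric.tendsto_nhds.2 fun ε hε => ?_⟩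
  filter_upwards [hV (ε / 2) (by positivity), hW (ε / 2) (by positivity)] with τ h1 h2
  rw [Real.dist_eq, abs_lt]
  constructor <;> linarith [h1 i, h2 i]

end IsFlow

/-! ### Integrals of nonnegative functions of time -/

theorem NonnegLocallyIntegrable.intervalIntegrable {f : ℝ → ℝ} (hf : NonnegLocallyIntegrable f)
    {s t : ℝ} (hs : 0 ≤ s) (hst : s ≤ t) : IntervalIntegrable f volume s t := by
  rw [intervalIntegrable_iff_integrableOn_Icc_of_le hst]
  exact (hf.2 (t + 1) (by linarith)).mono_set (Set.Icc_subset_Icc hs (by linarith))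

theorem NonnegLocallyIntegrable.mass_Ioc {f : ℝ → ℝ} (hf : NonnegLocallyIntegrable f)
    {s t : ℝ} (hs : 0 ≤ s) (hst : s ≤ t) :
    mass f (Set.Ioc s t) = ENNReal.ofReal (∫ τ in s..t, f τ) := by
  rw [mass, intervalIntegral.integral_of_le hst,
    ofReal_integral_eq_lintegral_ofReal (hf.intervalIntegrable hs hst).1]
  filter_upwards [ae_restrict_mem measurableSet_Ioc] with τ hτ
  exact hf.1 τ (hs.trans hτ.1.le)

theorem NonnegLocallyIntegrable.mass_Icc {f : ℝ → ℝ} (hf : NonnegLocallyIntegrable f)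
    {s t : ℝ} (hs : 0 ≤ s) (hst : s ≤ t) :
    mass f (Set.Icc s t) = ENNReal.ofReal (∫ τ in s..t, f τ) := by
  rw [← hf.mass_Ioc hs hst, mass, mass, restrict_Ioc_eq_restrict_Icc]

theorem NonnegLocallyIntegrable.integral_mono {f : ℝ → ℝ} (hf : NonnegLocallyIntegrable f)
    {r s t : ℝ} (hr : 0 ≤ r) (hrs : r ≤ s) (hst : s ≤ t) :
    ∫ τ in s..t, f τ ≤ ∫ τ in r..t, f τ := by
  refine intervalIntegral.integral_mono_interval hrs hst le_rfl ?_
    (hf.intervalIntegrable hr (hrs.trans hst))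
  filter_upwards [ae_restrict_mem measurableSet_Ioc] with τ hτ
  exact hf.1 τ (hr.trans hτ.1.le)

theorem NonnegLocallyIntegrable.exists_integral_pos {f : ℝ → ℝ} (hf : NonnegLocallyIntegrable f)
    {s : ℝ} (hs : 0 ≤ s) (hpos : 0 < mass f (Set.Ioi s)) :
    ∃ t, s ≤ t ∧ 0 < ∫ τ in s..t, f τ := by
  by_contra! hcon
  refine hpos.ne' (le_antisymm ?_ zero_le)
  have hU : Set.Ioi s = ⋃ n : ℕ, Set.Ioc s (s + n) := by
    ext τ
    simp only [Set.mem_Ioi, Set.mem_iUnion, Set.mem_Ioc, exists_and_left]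
    refine ⟨fun h => ⟨h, ?_⟩, fun h => h.1⟩
    obtain ⟨n, hn⟩ := exists_nat_ge (τ - s)
    exact ⟨n, by linarith⟩
  calc mass f (Set.Ioi s) ≤ ∑' n : ℕ, mass f (Set.Ioc s (s + n)) := by
        rw [hU]
        exact lintegral_iUnion_le _ _
    _ = 0 := by
        refine ENNReal.tsum_eq_zero.2 fun n => ?_
        have hn : s ≤ s + n := by simp
        rw [hf.mass_Ioc hs hn, ENNReal.ofReal_eq_zero]
        exact hcon _ hn

/-- Positive mass of the limit after time `r ≥ s` makes the original function active. -/
theorem ActiveAfter.of_intervalConv {f g : ℝ → ℝ} {t : ℕ → ℝ} (hf : NonnegLocallyIntegrable f)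
    (hg : NonnegLocallyIntegrable g) (ht : ∀ n, 0 ≤ t n)
    (hconv : IntervalConv (fun n s => f (t n + s)) g) {r s : ℝ} (hs : 0 ≤ s) (hsr : s ≤ r)
    (hpos : 0 < mass g (Set.Ioi r)) : ActiveAfter f t s := by
  obtain ⟨s', hrs', hint⟩ := hg.exists_integral_pos (hs.trans hsr) hpos
  refine ⟨s', (∫ τ in r..s', g τ) / 2, hsr.trans hrs', by positivity, ?_⟩
  filter_upwards [(hconv r s' (hs.trans hsr) hrs').eventually_const_lt (half_lt_self hint)]
    with n hn
  rw [intervalIntegral.integral_comp_add_left] at hn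
  exact hn.le.trans (hf.integral_mono (add_nonneg (ht n) hs) (by linarith) (by linarith))

/-! ### Persistence -/

/-- Each of the three persistence properties gives a uniform lower bound for the integrals over
all late windows of a fixed length. -/
theorem exists_eventually_le_mass {f : ℝ → ℝ}
    (hf : PersistentA f ∨ PersistentB f ∨ PersistentC f) :
    ∃ T μ : ℝ, 0 < T ∧ 0 < μ ∧
      ∀ᶠ τ in atTop, ENNReal.ofReal μ ≤ mass f (Set.Icc τ (τ + T)) := by
  rcases hf with hA | ⟨T, μ, hT, hμ, hB⟩ | ⟨T, μ, t, hT, hμ, -, htop, ⟨K, hK⟩, hC⟩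
  · obtain ⟨T, hT, hT0⟩ :=
      ((frequently_lt_of_lt_limsup (by isBoundedDefault) hA).and_eventually
        (eventually_gt_atTop (0 : ℝ))).exists
    obtain ⟨μ, hμ, hμ'⟩ := ENNReal.lt_iff_exists_nnreal_btwn.1 hT
    refine ⟨T, μ, hT0, by exact_mod_cast hμ, ?_⟩
    filter_upwards [eventually_lt_of_lt_liminf hμ' (by isBoundedDefault)] with τ hτ
    rw [ENNReal.ofReal_coe_nnreal]
    exact hτ.le
  · exact ⟨T, μ, hT, hμ, (eventually_ge_atTop 0).mono hB⟩
  · have hK0 : 0 ≤ K := (abs_nonneg _).trans (hK 0)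
    refine ⟨K + T, μ, by linarith, hμ, ?_⟩
    filter_upwards [eventually_ge_atTop (t 0)] with τ hτ
    -- The first `t n` after `τ` is at most `τ + K`.
    have hex : ∃ n, τ ≤ t n := (htop.eventually_ge_atTop τ).exists
    classical
    obtain ⟨n, hn, hn'⟩ : ∃ n, τ ≤ t n ∧ t n ≤ τ + K := by
      refine ⟨Nat.find hex, Nat.find_spec hex, ?_⟩
      rcases hm : Nat.find hex with _ | m
      · linarith
      · have h1 : t m < τ := not_le.1 (Nat.find_min hex (hm ▸ m.lt_succ_self))
        linarith [(abs_le.1 (hK m)).2]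
    exact (hC n).trans (lintegral_mono_set (Set.Icc_subset_Icc hn (by linarith)))

theorem ActiveAfter.of_persistent {f : ℝ → ℝ} (hf : NonnegLocallyIntegrable f)
    (hp : PersistentA f ∨ PersistentB f ∨ PersistentC f) {s : ℝ} (hs : 0 ≤ s) :
    ActiveAfter f (fun n => (n : ℝ)) s := by
  obtain ⟨T, μ, hT, hμ, hev⟩ := exists_eventually_le_mass hp
  refine ⟨s + T, μ, by linarith, hμ, ?_⟩
  filter_upwards [(tendsto_atTop_add_const_right _ s
    (tendsto_natCast_atTop_atTop (R := ℝ))).eventually hev] with n hn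
  have h0 : (0 : ℝ) ≤ n + s := by positivity
  rw [hf.mass_Icc h0 (by linarith), add_assoc] at hn
  have h1 : 0 ≤ ∫ τ in (n + s : ℝ)..(n + (s + T)), f τ :=
    intervalIntegral.integral_nonneg (by linarith) fun τ hτ => hf.1 τ (h0.trans hτ.1)
  exact (ENNReal.ofReal_le_ofReal_iff h1).1 hn

theorem PersistentlyReachable.nonnegLocallyIntegrable {N : ℕ} {a : Fin N → Fin N → ℝ → ℝ}
    (h : PersistentlyReachable a) (j k : Fin N) : NonnegLocallyIntegrable (a j k) := by
  obtain ⟨hmeas, hnn, hbd, -⟩ := h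
  refine ⟨hnn j k, fun T _ => ?_⟩
  obtain ⟨C, hC⟩ := hbd j k
  have hsub : Set.Icc 0 T ⊆ Set.Ici (0 : ℝ) := Set.Icc_subset_Ici_self
  refine Integrable.of_bound ((hmeas j k).aemeasurable.aestronglyMeasurable.mono_set hsub) C ?_
  filter_upwards [ae_restrict_mem measurableSet_Icc] with τ hτ
  rw [Real.norm_of_nonneg (hnn j k τ hτ.1)]
  exact hC τ hτ.1

/-! ### The nonlinear system -/

/-- The coordinates of a solution solve the linear system whose coefficients are evaluated along
the solution. -/
theorem IsSolution.isFlow {N : ℕ} {M : ℝ} {a : Fin N → Fin N → ℝ → EuclideanSpace ℝ (Fin N) → ℝ}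
    (ha : ∀ j k t y, 0 ≤ t → a j k t y ∈ Set.Icc 0 M) {x : ℝ → EuclideanSpace ℝ (Fin N)}
    (hx : IsSolution a x) : IsFlow M (fun j k t => a j k t (x t)) (fun i t => x t i) where
  bound j k t ht := ha j k t _ ht
  ac j T hT := (hx.1 T hT).lipschitzWith_comp (g := fun v : EuclideanSpace ℝ (Fin N) => v j)
    (EuclideanSpace.proj (𝕜 := ℝ) j).lipschitz
  deriv := hx.2

theorem IsFlow.exists_norm_sub_le {N : ℕ} {M : ℝ} {c : Fin N → Fin N → ℝ → ℝ}
    {x : ℝ → EuclideanSpace ℝ (Fin N)} (h : IsFlow M c fun i t => x t i) :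
    ∃ R, ∀ t, 0 ≤ t → ‖x t - x 0‖ ≤ R := by
  obtain ⟨C, hC⟩ := h.exists_abs_le
  have hn : ∀ t, 0 ≤ t → ‖x t‖ ≤ Real.sqrt (∑ _i : Fin N, C ^ 2) := fun t ht => by
    rw [EuclideanSpace.norm_eq]
    refine Real.sqrt_le_sqrt (Finset.sum_le_sum fun i _ => ?_)
    exact pow_le_pow_left₀ (norm_nonneg _) (hC i t ht) 2
  exact ⟨_, fun t ht => (norm_sub_le _ _).trans (add_le_add (hn t ht) (hn 0 le_rfl))⟩

/-- A trajectory may leave the balls that define the lower envelope for a while, but it stays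
bounded while their radii grow to infinity: from some time on, the envelope bounds the
coefficients along the trajectory from below. -/
theorem IsFlow.exists_lowerEnvelope_le {N : ℕ} [NeZero N] {M : ℝ} (hM : 0 < M)
    {a : Fin N → Fin N → ℝ → EuclideanSpace ℝ (Fin N) → ℝ}
    (ha : ∀ j k t y, 0 ≤ t → a j k t y ∈ Set.Icc 0 M) {x : ℝ → EuclideanSpace ℝ (Fin N)}
    (h : IsFlow M (fun j k t => a j k t (x t)) fun i t => x t i) :
    ∃ T₀, ∀ j k t, T₀ ≤ t → lowerEnvelope M a (x 0) j k t ≤ a j k t (x t) := by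
  obtain ⟨R, hR⟩ := h.exists_norm_sub_le
  have hN : 0 < M * Real.sqrt N :=
    mul_pos hM (Real.sqrt_pos.2 (Nat.cast_pos.2 (NeZero.pos N)))
  refine ⟨max 0 (R / (M * Real.sqrt N)), fun j k t ht => csInf_le ⟨0, ?_⟩ ⟨x t, ?_, rfl⟩⟩
  · rintro r ⟨y, -, rfl⟩
    exact (ha j k t y ((le_max_left _ _).trans ht)).1
  · refine (hR t ((le_max_left _ _).trans ht)).trans ?_
    rw [mul_comm, ← div_le_iff₀ hN]
    exact (le_max_right _ _).trans ht

end Consensus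

theorem mainTheorem4 (N : ℕ) (M : ℝ) (hM : 0 < M)
    (a : Fin N → Fin N → ℝ → EuclideanSpace ℝ (Fin N) → ℝ)
    (ha_bound : ∀ j k t y, 0 ≤ t → a j k t y ∈ Set.Icc 0 M)
    (ha_meas : ∀ j k, Consensus.UniversallyMeasurable
      (fun p : ℝ≥0 × EuclideanSpace ℝ (Fin N) => a j k (p.1 : ℝ) p.2))
    (x : ℝ → EuclideanSpace ℝ (Fin N)) (hx : Consensus.IsSolution a x)
    (henv : Consensus.LimitReachable (Consensus.lowerEnvelope M a (x 0)) ∨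
      Consensus.PersistentlyReachable (Consensus.lowerEnvelope M a (x 0)) ∨
      Consensus.LimitPairwiseJoined (Consensus.lowerEnvelope M a (x 0))) :
    ∃ xStar : ℝ, ∀ j, Tendsto (fun t => x t j) atTop (𝓝 xStar) := by
  open Consensus in
  rcases N.eq_zero_or_pos with rfl | hN
  · exact ⟨0, fun j => j.elim0⟩
  have : NeZero N := ⟨hN.ne'⟩
  have hflow := hx.isFlow ha_bound
  obtain ⟨T₀, hT₀⟩ := hflow.exists_lowerEnvelope_le hM ha_bound
  rcases henv with ⟨aStar, t, hlim, l, hl⟩ | hp | ⟨aStar, t, hlim, hG⟩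
  · refine hflow.exists_consensus_of_active
      (fun j k s t hs hst => (hlim.locInt j k).intervalIntegrable hs hst) hT₀
      hlim.times_nonneg hlim.times_tendsto
      (Or.inl ⟨l, fun i => Relation.ReflTransGen.mono ?_ _ _ (hl i)⟩)
    -- The tail graph only speaks of positive times, hence the mass after `s + 1`.
    exact fun j k hjk s hs => .of_intervalConv (hlim.locInt j k) (hlim.locInt_limit j k)
      hlim.times_nonneg (hlim.conv j k) hs (by linarith : s ≤ s + 1) (hjk (s + 1) (by linarith))
  · have hint := hp.nonnegLocallyIntegrable
    obtain ⟨-, -, -, l, hl⟩ := hp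
    refine hflow.exists_consensus_of_active
      (fun j k s t hs hst => (hint j k).intervalIntegrable hs hst) hT₀
      (fun n : ℕ => n.cast_nonneg) tendsto_natCast_atTop_atTop
      (Or.inl ⟨l, fun i => Relation.ReflTransGen.mono ?_ _ _ (hl i)⟩)
    exact fun j k hjk s hs => .of_persistent (hint j k) hjk hs
  · refine hflow.exists_consensus_of_active
      (fun j k s t hs hst => (hlim.locInt j k).intervalIntegrable hs hst) hT₀
      hlim.times_nonneg hlim.times_tendsto (Or.inr fun j k hjk => (hG j k hjk).imp ?_ ?_)
    all_goals
      exact fun hpos => .of_intervalConv (hlim.locInt _ _) (hlim.locInt_limit _ _)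
        hlim.times_nonneg (hlim.conv _ _) le_rfl le_rfl hpos
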